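/- Identify the states of the $3\times3\times3$ Rubik's cube with the elements of the Rubik's cube group $\mathcal R$, the subgroup of the symmetric group $S_{54}$ on the stickers generated by the clockwise quarter turns of the six faces $R, L, U, D, F, B$; the solved state is the identity. Let $G_{\mathcal R}$ be the Cayley graph of $\mathcal R$ with respect to the 18 moves of the half-turn metric, namely $M$, $M^{-1}$ and $M^2$ for $M\in\{R,L,U,D,F,B\}$. Let $D$ be the diameter of $G_{\mathcal R}$, i.e. the maximum distance between two of its vertices, and for a state $s$ let $d(s)$ be the distance in $G_{\mathcal R}$ from $s$ to the solved state. Let $S=(s_1,\dots,s_n)$ be a sample of $|S|=n\ge 1$ states, drawn independently and uniformly at random from all states, and let $\widehat\mu_S=\frac1{n}\sum_{i=1}^{n} d(s_i)$. Then \[ \Pr_S\left[\,D\ge 2\widehat\mu_S+0.36\,\right] < 2\exp\left(\frac{-n}{1\,541\,939}\right). \] -/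

import Mathlib

namespace Rubik

/-- The 54 stickers, labelled `1, …, 54` on the following net of the cube
(in `Fin 54` the label `54` is the element `0`).
```
              1  2  3
              4  U  6
              7  8  9
 10 11 12    19 20 21    28 29 30    37 38 39
 13  L 15    22  F 24    31  R 33    40  B 42
 16 17 18    25 26 27    34 35 36    43 44 45
             46 47 48
             49  D 51
             52 53 54
```
The centre stickers are `5, 14, 23, 32, 41, 50`. -/
abbrev Sticker : Type := Fin 54

/-- The six faces: right, left, up, down, front, back. -/
inductive Face : Type
  | R | L | U | D | F | B

/-- The 4-cycle `a ↦ b ↦ c ↦ d ↦ a` of stickers. -/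
def cyc (a b c d : Sticker) : Equiv.Perm Sticker := [a, b, c, d].formPerm

/-- The permutation of the stickers made by a clockwise quarter turn of a face: it sends a label `i`
to the label of the place to which the sticker at `i` is carried. -/
def turn : Face → Equiv.Perm Sticker
  | .R => cyc 3 43 48 21 * cyc 6 40 51 24 * cyc 9 37 54 27 * cyc 28 30 36 34 * cyc 29 33 35 31
  | .L => cyc 1 19 46 45 * cyc 4 22 49 42 * cyc 7 25 52 39 * cyc 10 12 18 16 * cyc 11 15 17 13
  | .U => cyc 1 3 9 7 * cyc 2 6 8 4 * cyc 10 37 28 19 * cyc 11 38 29 20 * cyc 12 39 30 21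
  | .D => cyc 16 25 34 43 * cyc 17 26 35 44 * cyc 18 27 36 45 * cyc 46 48 54 52 * cyc 47 51 53 49
  | .F => cyc 7 28 48 18 * cyc 8 31 47 15 * cyc 9 34 46 12 * cyc 19 21 27 25 * cyc 20 24 26 22
  | .B => cyc 1 16 54 30 * cyc 2 13 53 33 * cyc 3 10 52 36 * cyc 37 39 45 43 * cyc 38 42 44 40

/-- The Rubik's cube group: the subgroup of `S₅₄` generated by the six clockwise quarter turns. -/
def cubeGroup : Subgroup (Equiv.Perm Sticker) := Subgroup.closure (Set.range turn)

/-- The states of the Rubik's cube; the solved state is `1`. -/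
abbrev State : Type := cubeGroup

/-- The 18 moves of the half-turn metric: turns of one face by 90°, 270° or 180°. -/
def moves : Set State :=
  {m | ∃ f : Face, (m : Equiv.Perm Sticker) = turn f ∨ (m : Equiv.Perm Sticker) = (turn f)⁻¹ ∨
    (m : Equiv.Perm Sticker) = turn f ^ 2}

/-- The Rubik's cube graph: the Cayley graph of the cube group with respect to the moves. -/
def cubeGraph : SimpleGraph State := SimpleGraph.mulCayley moves

/-- The Rubik's cube graph is connected, so `SimpleGraph.dist` and `SimpleGraph.diam` are
the genuine distance and diameter. -/
theorem cubeGraph_connected : cubeGraph.Connected := by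
  have step : ∀ (u m : State), m ∈ moves → cubeGraph.Reachable u (u * m) := by
    intro u m hm
    by_cases h : u = u * m
    · rw [← h]
    · exact SimpleGraph.Adj.reachable
        ((SimpleGraph.mulCayley_adj' moves u (u * m)).2 ⟨h, m, hm, Or.inl rfl⟩)
  have key : ∀ (g : Equiv.Perm Sticker) (hg : g ∈ cubeGroup),
      cubeGraph.Reachable 1 (⟨g, hg⟩ : State) := by
    intro g hg
    induction hg using Subgroup.closure_induction_right with
    | one => exact SimpleGraph.Reachable.refl _
    | mul_right x hx y hy ih =>
      obtain ⟨f, rfl⟩ := hy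
      exact ih.trans (step ⟨x, hx⟩ ⟨turn f, Subgroup.subset_closure ⟨f, rfl⟩⟩ ⟨f, Or.inl rfl⟩)
    | mul_inv_cancel x hx y hy ih =>
      obtain ⟨f, rfl⟩ := hy
      exact ih.trans (step ⟨x, hx⟩ ⟨(turn f)⁻¹, inv_mem (Subgroup.subset_closure ⟨f, rfl⟩)⟩
        ⟨f, Or.inr (Or.inl rfl)⟩)
  exact (SimpleGraph.connected_iff _).2
    ⟨fun u v => (key u.1 u.2).symm.trans (key v.1 v.2), ⟨1⟩⟩

/-- The distance `d(s)` from a state `s` to the solved state. -/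
noncomputable def d (s : State) : ℕ := cubeGraph.dist s 1

/-- The average distance to the solved state over a sample of `n` states. -/
noncomputable def sampleMean {n : ℕ} (s : Fin n → State) : ℝ := (∑ i, (d (s i) : ℝ)) / n

/-- Every set of states is measurable. -/
instance instMeasurableSpaceState : MeasurableSpace State := ⊤

instance instDiscreteMeasurableSpaceState : DiscreteMeasurableSpace State := ⟨fun _ => trivial⟩

end Rubik

/-!
Let `μ` be the average distance of a state to the solved state. Left translations act transitively
on the Cayley graph, so `μ` is also the average distance to any other state. If `u` and `v` are at
distance `D`, then `D ≤ dist u s + dist s v` for every state `s`, and averaging over `s` gives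
`D ≤ 2 μ` (`diam_le_two_mul_meanDist`). Hence `D ≥ 2 μ̂ + 0.36` forces the sample mean `μ̂` to fall
short of its expectation `μ` by at least `0.18`. The distances are independent and bounded, so
Hoeffding's inequality (`measureReal_sampleMean_add_le`) makes this exponentially unlikely. With
distances in `[0, B]` the exponent is `-2 n (0.18 / B) ^ 2`, so the rate `1 / 1541939` needs only
some bound `B ≤ 316` on the distances.

Such a bound is `B = 154` (`d_le`). It comes from a stabilizer chain in the cube group: the stickers
of a list, one on each piece, are put in place one after another, each by a short word that does not
disturb the earlier ones. The words are listed in `transversals` and `lastTransversal`, and `B` is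
the sum over the steps of the longest word of the step. That the listed words cover every case
relies on the classical invariants of the cube (`exists_actsOnPieces`): the permutation of the
pieces is even, and the twists of the corners and the flips of the edges add up to zero. So two
corners alone cannot be exchanged (`ActsOnPieces.eq_one`), and a single corner or edge cannot be
turned in its place (`eq_one_of_fixes`).
-/

namespace Rubik

/-! ### Words in the moves -/

/-- A move `(f, k)` of the half-turn metric: `k + 1` clockwise quarter turns of the face `f`. -/
abbrev Move : Type := Face × Fin 3

/-- A sequence of moves, in the order in which they are made. -/
abbrev Word : Type := List Move

/-- The permutation of the stickers made by a word. As permutations are composed from right to left,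
the move made first is the rightmost factor. -/
def Word.perm : Word → Equiv.Perm Sticker
  | [] => 1
  | (f, k) :: w => Word.perm w * turn f ^ (k.val + 1)

/-- The `x`-th two-digit block of the decimal number `t`, counted from the right and from `0`.
Finite tables are stored as such numbers, and `lookup` is written with the bare functions on `ℕ`,
because the kernel evaluates these by fast arithmetic on numerals. -/
def lookup (t x : ℕ) : ℕ := Nat.mod (Nat.div t (Nat.pow 100 x)) 100

/-- The table of a quarter turn: block `x` is the image of the sticker `x`. -/
def turnTable : Face → ℕ
  | .R =>
    535224504921474645444842415139380034312835322936333009262506232203201918171615141312111037080740050443020127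
  | .L =>
    533951504248474501444304414007383736353433323130292827265224234921204616131017141118151209082506052203021900
  | .U =>
    535251504948474645444342414030292836353433323121201927262524232212111018171615141339383707040108050209060300
  | .D =>
    494653504700514818171642414039383745444333323130292836353424232221201927262515141312111009080706050403020152
  | .F =>
    535251504918151245444342414039383736354633324730294825221926232027242107171608141309111034312806050403020100
  | .B =>
    333651504948474643403744413845423903353402323101292827262524232221201918170015145312115209080706050410131630

theorem turn_val (f : Face) (x : Sticker) : (turn f x).val = lookup (turnTable f) x := by
  cases f <;> revert x <;> decide +kernel

/-- The place, as a natural number, to which `k + 1` quarter turns of a face carry a sticker. -/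
def Move.run : Move → ℕ → ℕ
  | (f, 0), x => lookup (turnTable f) x
  | (f, 1), x => lookup (turnTable f) (lookup (turnTable f) x)
  | (f, 2), x => lookup (turnTable f) (lookup (turnTable f) (lookup (turnTable f) x))

/-- The place, as a natural number, to which a word carries a sticker: `Word.perm` in a form that
is evaluated quickly. -/
def Word.run : Word → ℕ → ℕ
  | [], x => x
  | m :: w, x => Word.run w (m.run x)

theorem Word.perm_val (w : Word) (x : Sticker) : (w.perm x).val = w.run x := by
  induction w generalizing x with
  | nil => rfl
  | cons m w ih =>
    obtain ⟨f, k⟩ := m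
    rw [Word.perm, Equiv.Perm.mul_apply, ih, Word.run]
    congr 1
    fin_cases k <;> simp [Move.run, pow_succ, turn_val]

/-! ### Pieces and orientations -/

/-- The table of the pieces. Block `x` is the number of the piece that carries the sticker `x`:
`0, …, 7` for the corners, `8, …, 19` for the edges and `20, …, 25` for the centres. -/
def pieceTable : ℕ :=
  110310250901080003110215241404160502100114231305180601080013221206190700090312211507170406190718201705160402

/-- The table of the orientations. The stickers of a corner have the orientations `0, 2, 4`,
clockwise seen from outside the cube, and those of an edge have the orientations `0, 3`. -/
def orientTable : ℕ :=
  2030400000004030202030403000304030202030400000004030202030403000304030200000000000000000000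

/-- The piece that carries a sticker. -/
def piece (x : Sticker) : Fin 26 := Fin.ofNat 26 (lookup pieceTable x)

/-- The orientation of a sticker on its piece. Twists of corners are multiples of `2` and flips of
edges are multiples of `3` in `ZMod 6`, so one sum over all the pieces records both the total twist
and the total flip. -/
def orient (x : Sticker) : ZMod 6 := (lookup orientTable x : ℕ)

/-- A sticker on a corner piece. -/
def IsCorner (x : Sticker) : Prop := (piece x).val < 8

instance : DecidablePred IsCorner := fun x => inferInstanceAs (Decidable ((piece x).val < 8))

/-- The centre stickers of the six faces. -/
def centres : List Sticker := [5, 14, 23, 32, 41, 50]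

/-- `g` moves the pieces by the even permutation `σ` and turns the piece `k` by `ψ k`, where the
turns add up to zero. It keeps corners and edges apart and fixes the centres. -/
structure ActsOnPieces (g : Equiv.Perm Sticker) (σ : Equiv.Perm (Fin 26)) (ψ : Fin 26 → ZMod 6) :
    Prop where
  piece_apply : ∀ x, piece (g x) = σ (piece x)
  orient_apply : ∀ x, orient (g x) = orient x + ψ (piece x)
  isCorner_apply : ∀ x, IsCorner (g x) ↔ IsCorner x
  centre_apply : ∀ c ∈ centres, g c = c
  sign_eq : Equiv.Perm.sign σ = 1
  sum_eq : ∑ k, ψ k = 0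

theorem ActsOnPieces.one : ActsOnPieces 1 1 0 := by
  constructor <;> simp

theorem ActsOnPieces.mul {g h : Equiv.Perm Sticker} {σ τ : Equiv.Perm (Fin 26)}
    {ψ φ : Fin 26 → ZMod 6} (hg : ActsOnPieces g σ ψ) (hh : ActsOnPieces h τ φ) :
    ActsOnPieces (g * h) (σ * τ) (fun k => φ k + ψ (τ k)) where
  piece_apply x := by simp [hg.piece_apply, hh.piece_apply]
  orient_apply x := by simp [hg.orient_apply, hh.orient_apply, hh.piece_apply, add_assoc]
  isCorner_apply x := by simp [hg.isCorner_apply, hh.isCorner_apply]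
  centre_apply c hc := by simp [hg.centre_apply c hc, hh.centre_apply c hc]
  sign_eq := by simp [hg.sign_eq, hh.sign_eq]
  sum_eq := by rw [Finset.sum_add_distrib, hh.sum_eq, Equiv.sum_comp τ ψ, hg.sum_eq, add_zero]

theorem ActsOnPieces.inv {g : Equiv.Perm Sticker} {σ : Equiv.Perm (Fin 26)}
    {ψ : Fin 26 → ZMod 6} (hg : ActsOnPieces g σ ψ) :
    ActsOnPieces g⁻¹ σ⁻¹ (fun k => -ψ (σ⁻¹ k)) := by
  have hi : ∀ x, g (g⁻¹ x) = x := g.apply_symm_apply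
  have hp : ∀ x, piece (g⁻¹ x) = σ⁻¹ (piece x) := fun x => by
    rw [Equiv.Perm.eq_inv_iff_eq, ← hg.piece_apply, hi]
  refine ⟨hp, fun x => ?_, fun x => ?_, fun c hc => ?_, ?_, ?_⟩
  · have := hg.orient_apply (g⁻¹ x)
    rw [hi, hp] at this
    rw [this, add_neg_cancel_right]
  · rw [← hg.isCorner_apply, hi]
  · rw [Equiv.Perm.inv_eq_iff_eq, hg.centre_apply c hc]
  · rw [Equiv.Perm.sign_inv, hg.sign_eq]
  · rw [Finset.sum_neg_distrib, Equiv.sum_comp σ⁻¹ ψ, hg.sum_eq, neg_zero]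

/-- The 4-cycles of corners and of edges made by a quarter turn, each piece given by one of its
stickers. -/
def turnCycles : Face → List Sticker × List Sticker
  | .R => ([3, 43, 48, 21], [6, 40, 51, 24])
  | .L => ([1, 19, 46, 45], [4, 22, 49, 42])
  | .U => ([1, 3, 9, 7], [2, 6, 8, 4])
  | .D => ([16, 25, 34, 43], [17, 26, 35, 44])
  | .F => ([7, 28, 48, 18], [8, 31, 47, 15])
  | .B => ([1, 16, 54, 30], [2, 13, 53, 33])

theorem sign_formPerm_of_length_four {α : Type*} [Fintype α] [DecidableEq α] {l : List α}
    (hl : l.length = 4) (hn : l.Nodup) : Equiv.Perm.sign l.formPerm = -1 := by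
  rw [(List.isCycle_formPerm hn (by omega)).sign, List.support_formPerm_of_nodup l hn
    (by rintro x rfl; simp at hl), List.toFinset_card_of_nodup hn, hl]
  rfl

/-- A quarter turn moves four corners and four edges in cycles. It changes the orientations of
each piece that it moves, but the changes cancel in the sum. -/
theorem exists_actsOnPieces_turn (f : Face) : ∃ σ ψ, ActsOnPieces (turn f) σ ψ := by
  -- the sum has one term only: the sticker of orientation `0` on the piece `k`
  refine ⟨((turnCycles f).1.map piece).formPerm * ((turnCycles f).2.map piece).formPerm,
    fun k => ∑ x : Sticker with piece x = k ∧ orient x = 0, orient (turn f x),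
    ?_, ?_, ?_, ?_, ?_, ?_⟩
  · cases f <;> decide +kernel
  · cases f <;> decide +kernel
  · cases f <;> decide +kernel
  · cases f <;> decide +kernel
  · rw [Equiv.Perm.sign_mul, sign_formPerm_of_length_four, sign_formPerm_of_length_four]
    · rfl
    all_goals cases f <;> decide +kernel
  · cases f <;> decide +kernel

theorem exists_actsOnPieces {g : Equiv.Perm Sticker} (hg : g ∈ cubeGroup) :
    ∃ σ ψ, ActsOnPieces g σ ψ := by
  induction hg using Subgroup.closure_induction with
  | mem x hx => obtain ⟨f, rfl⟩ := hx; exact exists_actsOnPieces_turn f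
  | one => exact ⟨_, _, .one⟩
  | mul x y _ _ hx hy =>
    obtain ⟨_, _, hx⟩ := hx
    obtain ⟨_, _, hy⟩ := hy
    exact ⟨_, _, hx.mul hy⟩
  | inv x _ hx =>
    obtain ⟨_, _, hx⟩ := hx
    exact ⟨_, _, hx.inv⟩

/-! ### Short words for a stabilizer chain -/

namespace Move

/- The moves in the usual notation: `R` is a clockwise quarter turn, `R2` a half turn and `R'` an
anticlockwise quarter turn of the right face, and similarly for the other faces. -/

def R : Move := (.R, 0)
def R2 : Move := (.R, 1)
def R' : Move := (.R, 2)
def L : Move := (.L, 0)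
def L2 : Move := (.L, 1)
def L' : Move := (.L, 2)
def U : Move := (.U, 0)
def U2 : Move := (.U, 1)
def U' : Move := (.U, 2)
def D : Move := (.D, 0)
def D2 : Move := (.D, 1)
def D' : Move := (.D, 2)
def F : Move := (.F, 0)
def F2 : Move := (.F, 1)
def F' : Move := (.F, 2)
def B : Move := (.B, 0)
def B2 : Move := (.B, 1)
def B' : Move := (.B, 2)

end Move

open Move in
/-- The steps of the sifting. An entry `(b, T)` serves to put the sticker `b` in place: the words in
`T` keep the centres and the stickers of the earlier entries in place, and they carry `b` to every
place where it can be once these are solved (`isChain_transversals`). Eleven edges come first and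
six corners follow. -/
def transversals : List (Sticker × List Word) := [
  (47, [
     [], [F2], [F], [F'], [D'], [D], [D2], [F2, U2], [F2, U], [F2, U'], [F, L'], [F, L2], [F, L],
     [D', L'], [D, R], [F', R], [F', R2], [F', R'], [D, R'], [D', L], [F, L', U'], [F, L, D],
     [F, L', U], [F, L, D']]),
  (49, [
     [], [L2], [L'], [L], [L2, U], [L2, U2], [L2, U'], [L, B'], [L, B2], [L, B], [L, B', U'],
     [L2, U, B], [F', D, F], [F', L', F], [F2, L', F2], [L, B', U], [F, D, F'], [L2, U, B'],
     [F2, D2, F2], [F2, D', F2], [L', F', D', F], [F, D, F', R']]),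
  (51, [
     [], [R2], [R], [R'], [R2, U'], [R2, U2], [R2, U], [R', B], [R', B2], [R', B'], [R', B, U'],
     [R2, U', B], [D', F, D], [F, R, F'], [F2, R, F2], [R', B, U], [D', F', D], [D, B, D'],
     [R2, U', B2], [R2, U', B', R]]),
  (53, [
     [], [B2], [B'], [B], [B2, U'], [B2, U], [B2, U2], [L', B', L], [L2, B', L2], [D, L', D'],
     [D', R, D], [R, B, R'], [D2, F', D2], [D', R', D], [D, L, D'], [L', B', L, U'], [D, L, D', B'],
     [B, D', R, D]]),
  (22, [
     [], [L', U, L], [L', U2, L], [L', U', L], [F, U, F'], [F, U', F'], [F, U2, F'], [F', L, F, L'],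
     [F, U, F', U'], [L2, F2, L2, F2], [R2, F2, R2, F2], [F2, L2, F2, L2], [F, L, U, L', F'],
     [R, F, U', F', R'], [R', F, U', R, F'], [R', F2, R, F', U, F']]),
  (24, [
     [], [R, U', R'], [R, U2, R'], [R, U, R'], [F', U, F], [F', U', F], [F', U2, F], [F, R', F', R],
     [R2, F, R2, F'], [F, R2, F', R2], [B2, R2, B2, R2], [F', L, U, L', F], [F', R', U', R, F],
     [R, F, R', F', U', R']]),
  (40, [
     [], [R', U', R], [R', U2, R], [R', U, R], [B, U', B'], [B, U2, B'], [B, U, B'],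
     [B2, R, B2, R'], [R, B', R', B], [B2, L', B2, L], [L', D', B', D, L], [B, U', B, L', B2, L]]),
  (42, [
     [], [L, U, L'], [L, U2, L'], [L, U', L'], [B', U', B], [B', U2, B], [B', U, B], [B, L', B', L],
     [L', B, L, B'], [L, U', L', B', U2, B]]),
  (2, [
     [], [U'], [U], [U2], [L, F, U2, F', U2, L'], [F', L', U', L, U, F], [R', F', U2, F, U2, R],
     [U', L, U2, F, U2, F', L']]),
  (4, [
     [], [F, U2, R, U2, R', F'], [R', U', F', U, F, R], [L, F, U, F', U', L'],
     [L, U, F, U', F', L'], [F', U', L', U, L, F, U]]),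
  (6, [
     [], [F2, U2, F2, U, F2, U, F2, U], [R2, F, R', F', R', F, R', F'],
     [F, U', R, U, R', U, F', U']]),
  (46, [
     [], [D2, B, U', B', D2, B, U, B'], [F', R2, F, L2, F', R2, F, L2],
     [U, F2, U', B2, U, F2, U', B2], [F2, U', B2, U, F2, U', B2, U], [F2, D', B, D, F2, D', B', D],
     [U2, B', D2, B, U2, B', D2, B], [D, R2, D', L, D, R2, D', L'], [U', B', D2, B, U, B', D2, B],
     [F, R, F', L', F, R', F', L], [B', D2, B, U', B', D2, B, U], [D', B2, D, F, D', B2, D, F'],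
     [U', B, U, F2, U', B', U, F2], [U', B', U, F2, U', B, U, F2], [B', R', F2, R, B, R', F2, R],
     [F2, L, B', L', F2, L, B, L'], [F2, D', B', D, F2, D', B, D], [F, L, F', R2, F, L', F', R2],
     [U', B2, U, F2, U', B2, U, F2], [D2, B2, D', F2, D, B2, D', F2, D'],
     [F2, U2, F, D2, F', U2, F, D2, F], [L2, B2, L, F2, L', B2, L, F2, L],
     [L, B2, R, B', L', B, R', B', F2, L, B', L', F2],
     [F2, L, B, L', F2, B, R, B', L, B, R', B2, L']]),
  (48, [
     [], [F2, R', B', R, F2, R', B, R], [F2, D, B2, D', F2, D, B2, D'],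
     [F, L2, F', R2, F, L2, F', R2], [F2, U, B2, U', F2, U, B2, U'], [B, D2, B', U', B, D2, B', U],
     [U', F, D, F', U, F, D', F'], [U, B', U', F2, U, B, U', F2], [U, B, D2, B', U', B, D2, B'],
     [F, L2, F', R', F, L2, F', R], [U2, B, D2, B', U2, B, D2, B'], [F2, D, B', D', F2, D, B, D'],
     [B, L, F2, L', B', L, F2, L'], [U, B, U', F2, U, B', U', F2], [F, L2, F', R, F, L2, F', R'],
     [B', L, F2, L', B, L, F2, L'], [D2, B', U', B, D2, B', U, B],
     [D2, B2, D, F2, D', B2, D, F2, D], [F2, U2, F', D2, F, U2, F', D2, F'],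
     [U, B', U', F2, U, B2, D, B', U', B, D', B', F2],
     [F2, B, D, B', U, B, D', B2, U', F2, U, B, U']]),
  (0, [
     [], [R, F2, R', B2, R, F2, R', B2], [F', L', F, R2, F', L, F, R2],
     [R2, F', L2, F, R2, F', L2, F], [L, F, R2, F', L', F, R2, F'], [U2, R, D, R', U2, R, D', R'],
     [B', L', F2, L, B, L', F2, L], [B2, R, F2, R', B2, R, F2, R'], [U', R, D, R', U, R, D', R'],
     [L', F2, L, B', L', F2, L, B], [R, F2, R', B', R, F2, R', B], [U2, L, D2, L', U2, L, D2, L'],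
     [U, R, D, R', U', R, D', R'], [L2, U', R2, U, L2, U', R2, U],
     [U', B2, U', F', U, B2, U', F, U2], [L, B2, L, F, L', B2, L, F', L2],
     [R, F2, R', B', R, F2, B', L', B, R', B', L, B2],
     [B2, L', B, R, B', L, B, F2, R', B, R, F2, R']]),
  (52, [
     [], [L', F2, L, B2, L', F2, L, B2], [L2, F, R, F', L2, F, R', F'],
     [F, R, F', L2, F, R', F', L2], [L', F2, L, B, L', F2, L, B'], [U', R', D2, R, U, R', D2, R],
     [U, L', D', L, U', L', D, L], [B2, L', F2, L, B2, L', F2, L], [U2, L', D', L, U2, L', D, L],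
     [U, R', D2, R, U', R', D2, R], [U', L', D', L, U, L', D, L], [U2, R', D2, R, U2, R', D2, R],
     [U, B2, U, F, U', B2, U, F', U2], [L', F2, L, B, L', F2, B, R, B', L, B, R', B2],
     [B2, R, B', L', B, R', B', F2, L, B', L', F2, L]]),
  (1, [
     [], [F, R', F', L, F, R, F', L'], [B, L, F, L', B', L, F', L'], [L, F, R, F', L', F, R', F'],
     [R', F', R, B', R', F, R, B], [F, R, F', L, F, R', F', L'], [L, F, L', B, L, F', L', B'],
     [F2, L2, F', R2, F, L2, F', R2, F'], [F', L2, F', R2, F, L2, F', R2, F2],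
     [L2, F2, L, B2, L', F2, L, B2, L], [F, R', F', L, F, R2, B, R', F', R, B', L', R'],
     [F, R, F', L, F, R', F2, L', B, L, F, L', B']]),
  (3, [
     [], [R, B, R', F, R, B', R', F'], [F, R, B, R', F', R, B', R'], [F, U', B', U, F', U', B, U],
     [U', B', U, F, U', B, U, F'], [L2, B2, L', F2, L, B2, L', F2, L'],
     [F', U2, F', D', F, U2, F', D, F2], [F, U', B', U, F', U', R', F', R, B, R', F, R, U],
     [R, B, R', F, R, B', R', U', B', U, F', U', B, U]])]

open Move in
/-- The last step of the sifting: the empty word and two words that twist the corners of `9` and `7`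
in opposite directions and keep all the other pieces in place. -/
def lastTransversal : List Word :=
  [[],
   [R, U, R2, U', B, R', F, R, B', U, R2, U', R', F'],
   [R, F', R', F2, D, F', U', F, D', F2, R, F, R', U]]

/-! ### Distances in the Cayley graph -/

theorem Word.perm_mem (w : Word) : w.perm ∈ cubeGroup := by
  induction w with
  | nil => exact one_mem _
  | cons m w ih => exact mul_mem ih (pow_mem (Subgroup.subset_closure (Set.mem_range_self m.1)) _)

/-- The state reached from the solved state by a word. -/
def Word.state (w : Word) : State := ⟨w.perm, w.perm_mem⟩

theorem dist_mul_left_le (g u v : State) : cubeGraph.dist (g * u) (g * v) ≤ cubeGraph.dist u v := by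
  obtain ⟨p, hp⟩ := cubeGraph_connected.exists_walk_length_eq_dist u v
  let f : cubeGraph →g cubeGraph :=
    ⟨fun x => g * x, fun {a b} h => SimpleGraph.mulCayley_adj_mul_iff_right.2 h⟩
  rw [← hp, ← SimpleGraph.Walk.length_map f p]
  exact SimpleGraph.dist_le _

/-- Left translations are automorphisms of the Cayley graph. -/
theorem dist_mul_left (g u v : State) : cubeGraph.dist (g * u) (g * v) = cubeGraph.dist u v :=
  (dist_mul_left_le g u v).antisymm (by simpa using dist_mul_left_le g⁻¹ (g * u) (g * v))

theorem d_mul_le (g h : State) : d (g * h) ≤ d h + d g := by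
  have h1 := cubeGraph_connected.dist_triangle (u := g * h) (v := g) (w := 1)
  have h2 := dist_mul_left g h 1
  rw [mul_one] at h2
  rwa [h2] at h1

theorem d_le_one_of_mem_moves {m : State} (hm : m ∈ moves) : d m ≤ 1 := by
  by_cases h : m = 1
  · simp [d, h]
  · exact (SimpleGraph.dist_eq_one_iff_adj.2
      ((SimpleGraph.mulCayley_adj' moves m 1).2 ⟨h, m, hm, Or.inr (one_mul m).symm⟩)).le

theorem turn_pow_four (f : Face) : turn f ^ 4 = 1 := by
  ext x
  have h : turn f ^ 4 = Word.perm [(f, 2), (f, 0)] := rfl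
  rw [h, Word.perm_val, Equiv.Perm.one_apply]
  revert x
  cases f <;> decide +kernel

theorem Word.d_state_le (w : Word) : d w.state ≤ w.length := by
  induction w with
  | nil =>
    have : Word.state [] = 1 := rfl
    simp [d, this]
  | cons m w ih =>
    obtain ⟨f, k⟩ := m
    have hf : turn f ∈ cubeGroup := Subgroup.subset_closure ⟨f, rfl⟩
    let t : State := ⟨turn f ^ (k.val + 1), pow_mem hf _⟩
    have ht : t ∈ moves := by
      refine ⟨f, ?_⟩
      fin_cases k
      · exact Or.inl (pow_one _)
      · exact Or.inr (Or.inr rfl)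
      · exact Or.inr (Or.inl (eq_inv_of_mul_eq_one_left
          ((pow_succ (turn f) 3).symm.trans (turn_pow_four f))))
    have hw : Word.state ((f, k) :: w) = Word.state w * t := rfl
    rw [hw, List.length_cons]
    have := d_mul_le (Word.state w) t
    have := d_le_one_of_mem_moves ht
    omega

/-! ### Sifting through a stabilizer chain -/

/-- The greatest length of a word in a list. -/
def maxLength (T : List Word) : ℕ := (T.map List.length).foldr max 0

theorem length_le_maxLength {T : List Word} {w : Word} (hw : w ∈ T) : w.length ≤ maxLength T := by
  induction T with
  | nil => simp at hw
  | cons v T ih =>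
    simp only [maxLength, List.map_cons, List.foldr_cons] at ih ⊢
    rcases List.mem_cons.1 hw with rfl | hw
    · exact le_max_left _ _
    · exact (ih hw).trans (le_max_right _ _)

/-- If the state `g` keeps the stickers in `F` in place, and so does a word that carries `b` to the
same place as `g` does, then after division by this word `g` keeps `b` in place as well. -/
theorem d_le_add_maxLength {F : List Sticker} {b : Sticker} {T : List Word} {k : ℕ}
    (hT : ∀ w ∈ T, ∀ y ∈ F, w.run y = y)
    (hk : ∀ h : State, (∀ y ∈ b :: F, h.1 y = y) → d h ≤ k) {g : State} (hg : ∀ y ∈ F, g.1 y = y)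
    (hb : (g.1 b).val ∈ T.map (Word.run · b)) : d g ≤ k + maxLength T := by
  obtain ⟨w, hw, hwb⟩ := List.mem_map.1 hb
  have h1 : d (w.state⁻¹ * g) ≤ k := by
    refine hk _ fun y hy => ?_
    change w.perm⁻¹ (g.1 y) = y
    rw [Equiv.Perm.inv_eq_iff_eq]
    rcases List.mem_cons.1 hy with rfl | hy
    · exact Fin.ext (hwb.symm.trans (w.perm_val y).symm)
    · rw [hg y hy]
      exact Fin.ext ((hT w hw y hy).symm.trans (w.perm_val y).symm)
  have h2 := d_mul_le w.state (w.state⁻¹ * g)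
  rw [mul_inv_cancel_left] at h2
  have h3 := w.d_state_le
  have h4 := length_le_maxLength hw
  omega

/-- The words in `T` keep the stickers in `F` in place, and they carry `b` to every place on a piece
of the same kind as that of `b` that has no sticker in `F`. -/
def IsTransversal (F : List Sticker) (b : Sticker) (T : List Word) : Prop :=
  (∀ w ∈ T, ∀ y ∈ F, w.run y = y) ∧ (∀ y ∈ F, piece b ≠ piece y) ∧
    ∀ x : Sticker, (IsCorner x ↔ IsCorner b) → (∀ y ∈ F, piece x ≠ piece y) →
      x.val ∈ T.map (Word.run · b)

instance (F : List Sticker) (b : Sticker) (T : List Word) : Decidable (IsTransversal F b T) :=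
  @instDecidableAnd _ _ inferInstance (@instDecidableAnd _ _ inferInstance inferInstance)

/-- Each entry `(b, T)` of the list is a transversal for the stickers in `F` and those that come
earlier in the list. -/
def IsChain : List Sticker → List (Sticker × List Word) → Prop
  | _, [] => True
  | F, (b, T) :: l => IsTransversal F b T ∧ IsChain (b :: F) l

instance instDecidableIsChain : ∀ F l, Decidable (IsChain F l)
  | _, [] => .isTrue trivial
  | F, (b, T) :: l =>
    have := instDecidableIsChain (b :: F) l
    inferInstanceAs (Decidable (IsTransversal F b T ∧ IsChain (b :: F) l))

/-- The stickers in `F` and those of a chain. -/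
def chainBase : List Sticker → List (Sticker × List Word) → List Sticker
  | F, [] => F
  | F, (b, _) :: l => chainBase (b :: F) l

/-- The sum of the greatest lengths of the words in the entries of a chain. -/
def chainLength : List (Sticker × List Word) → ℕ
  | [] => 0
  | (_, T) :: l => chainLength l + maxLength T

theorem ActsOnPieces.apply_piece {g : Equiv.Perm Sticker} {σ : Equiv.Perm (Fin 26)}
    {ψ : Fin 26 → ZMod 6} (h : ActsOnPieces g σ ψ) {y : Sticker} (hy : g y = y) :
    σ (piece y) = piece y := by
  rw [← h.piece_apply, hy]

theorem ActsOnPieces.apply_eq_zero {g : Equiv.Perm Sticker} {σ : Equiv.Perm (Fin 26)}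
    {ψ : Fin 26 → ZMod 6} (h : ActsOnPieces g σ ψ) {y : Sticker} (hy : g y = y) :
    ψ (piece y) = 0 := by
  simpa [hy] using h.orient_apply y

theorem ActsOnPieces.piece_apply_ne {g : Equiv.Perm Sticker} {σ : Equiv.Perm (Fin 26)}
    {ψ : Fin 26 → ZMod 6} (h : ActsOnPieces g σ ψ) {F : List Sticker} (hF : ∀ y ∈ F, g y = y)
    {x : Sticker} (hx : ∀ y ∈ F, piece x ≠ piece y) : ∀ y ∈ F, piece (g x) ≠ piece y := by
  intro y hy e
  rw [h.piece_apply, ← h.apply_piece (hF y hy)] at e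
  exact hx y hy (σ.injective e)

/-- Sifting through a chain: a state that keeps `F` in place is reduced, step by step, to one that
keeps the stickers of the chain in place as well. -/
theorem d_le_of_isChain {k : ℕ} (l : List (Sticker × List Word)) (F : List Sticker)
    (hl : IsChain F l) (hk : ∀ h : State, (∀ y ∈ chainBase F l, h.1 y = y) → d h ≤ k) {g : State}
    (hg : ∀ y ∈ F, g.1 y = y) : d g ≤ k + chainLength l := by
  induction l generalizing F g with
  | nil => exact hk g hg
  | cons e l ih =>
    obtain ⟨b, T⟩ := e
    obtain ⟨⟨h1, h2, h3⟩, h4⟩ := hl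
    rw [chainLength, ← add_assoc]
    refine d_le_add_maxLength h1 (fun h hh => ih _ h4 hk hh) hg ?_
    obtain ⟨σ, ψ, hσ⟩ := exists_actsOnPieces g.2
    exact h3 _ (hσ.isCorner_apply b) (hσ.piece_apply_ne hg h2)

theorem isChain_transversals : IsChain centres transversals := by decide +kernel

/-- The centre stickers and the stickers of `transversals`: one sticker of each piece but the
corners of `7` and `9` and the edge of `8`. -/
def base : List Sticker := chainBase centres transversals

theorem exists_mem_base_or (k : Fin 26) :
    (∃ y ∈ base, piece y = k) ∨ k = piece 7 ∨ k = piece 8 ∨ k = piece 9 := by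
  revert k; decide +kernel

theorem piece_ne_of_mem_base :
    ∀ y ∈ base, piece 7 ≠ piece y ∧ piece 8 ≠ piece y ∧ piece 9 ≠ piece y := by
  decide +kernel

theorem piece_eq_of_not_mem_base : ∀ x : Sticker, (∀ y ∈ base, piece x ≠ piece y) →
    if IsCorner x then piece x = piece 7 ∨ piece x = piece 9 else piece x = piece 8 := by
  decide +kernel

theorem ActsOnPieces.apply_edge {g : Equiv.Perm Sticker} {σ : Equiv.Perm (Fin 26)}
    {ψ : Fin 26 → ZMod 6} (h : ActsOnPieces g σ ψ) (hF : ∀ y ∈ base, g y = y) :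
    σ (piece 8) = piece 8 := by
  have := piece_eq_of_not_mem_base _
    (h.piece_apply_ne hF fun y hy => (piece_ne_of_mem_base y hy).2.1)
  rwa [if_neg (by rw [h.isCorner_apply]; decide +kernel), h.piece_apply] at this

theorem ActsOnPieces.apply_corner {g : Equiv.Perm Sticker} {σ : Equiv.Perm (Fin 26)}
    {ψ : Fin 26 → ZMod 6} (h : ActsOnPieces g σ ψ) (hF : ∀ y ∈ base, g y = y) :
    σ (piece 7) = piece 7 ∨ σ (piece 7) = piece 9 := by
  have := piece_eq_of_not_mem_base _
    (h.piece_apply_ne hF fun y hy => (piece_ne_of_mem_base y hy).1)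
  rwa [if_pos (by rw [h.isCorner_apply]; decide +kernel), h.piece_apply] at this

theorem ActsOnPieces.apply_corner' {g : Equiv.Perm Sticker} {σ : Equiv.Perm (Fin 26)}
    {ψ : Fin 26 → ZMod 6} (h : ActsOnPieces g σ ψ) (hF : ∀ y ∈ base, g y = y) :
    σ (piece 9) = piece 7 ∨ σ (piece 9) = piece 9 := by
  have := piece_eq_of_not_mem_base _
    (h.piece_apply_ne hF fun y hy => (piece_ne_of_mem_base y hy).2.2)
  rwa [if_pos (by rw [h.isCorner_apply]; decide +kernel), h.piece_apply] at this

/-- Two corners alone cannot be exchanged, because the permutation of the pieces is even. -/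
theorem ActsOnPieces.eq_one {g : Equiv.Perm Sticker} {σ : Equiv.Perm (Fin 26)}
    {ψ : Fin 26 → ZMod 6} (h : ActsOnPieces g σ ψ) (hF : ∀ y ∈ base, g y = y) : σ = 1 := by
  have h79 : piece 7 ≠ piece 9 := by decide +kernel
  have h78 : piece 8 ≠ piece 7 ∧ piece 8 ≠ piece 9 := by decide +kernel
  have hb : ∀ y ∈ base, σ (piece y) = piece y := fun y hy => h.apply_piece (hF y hy)
  have h8 := h.apply_edge hF
  rcases h.apply_corner hF with h7 | h7
  · have h9 : σ (piece 9) = piece 9 := (h.apply_corner' hF).resolve_left fun e =>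
      h79 (σ.injective (h7.trans e.symm))
    ext1 k
    rcases exists_mem_base_or k with ⟨y, hy, rfl⟩ | rfl | rfl | rfl
    exacts [hb y hy, h7, h8, h9]
  · have h9 : σ (piece 9) = piece 7 := (h.apply_corner' hF).resolve_right fun e =>
      h79 (σ.injective (h7.trans e.symm))
    have hswap : σ = Equiv.swap (piece 7) (piece 9) := by
      ext1 k
      rcases exists_mem_base_or k with ⟨y, hy, rfl⟩ | rfl | rfl | rfl
      · obtain ⟨hy7, -, hy9⟩ := piece_ne_of_mem_base y hy
        rw [hb y hy, Equiv.swap_apply_of_ne_of_ne hy7.symm hy9.symm]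
      · rw [h7, Equiv.swap_apply_left]
      · rw [h8, Equiv.swap_apply_of_ne_of_ne h78.1 h78.2]
      · rw [h9, Equiv.swap_apply_right]
    have := h.sign_eq
    rw [hswap, Equiv.Perm.sign_swap h79] at this
    exact absurd this (by decide)

/-- A single corner cannot be twisted and a single edge cannot be flipped, because the turns of the
pieces add up to zero. -/
theorem eq_one_of_fixes {g : State} (hF : ∀ y ∈ 9 :: base, g.1 y = y) : g = 1 := by
  obtain ⟨σ, ψ, h⟩ := exists_actsOnPieces g.2
  have hbase : ∀ y ∈ base, g.1 y = y := fun y hy => hF y (List.mem_cons_of_mem _ hy)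
  have hσ := h.eq_one hbase
  have h9 : ψ (piece 9) = 0 := h.apply_eq_zero (hF 9 List.mem_cons_self)
  have hb : ∀ y ∈ base, ψ (piece y) = 0 := fun y hy => h.apply_eq_zero (hbase y hy)
  have hpiece : ∀ x, piece (g.1 x) = piece x := fun x => by rw [h.piece_apply, hσ]; rfl
  have hsum : ψ (piece 7) + ψ (piece 8) = 0 := by
    rw [← h.sum_eq]
    refine (Fintype.sum_eq_add _ _ (by decide +kernel) fun k hk => ?_).symm
    rcases exists_mem_base_or k with ⟨y, hy, rfl⟩ | rfl | rfl | rfl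
    exacts [hb y hy, absurd rfl hk.1, absurd rfl hk.2, h9]
  have h7 : ψ (piece 7) = orient (g.1 7) := by
    rw [h.orient_apply, show orient 7 = 0 by decide +kernel, zero_add]
  have h8 : ψ (piece 8) = orient (g.1 8) := by
    rw [h.orient_apply, show orient 8 = 0 by decide +kernel, zero_add]
  -- the first summand is a multiple of `2` and the second one a multiple of `3`
  have hzero : ∀ x y : Sticker, piece x = piece 7 → piece y = piece 8 → orient x + orient y = 0 →
      orient x = 0 ∧ orient y = 0 := by
    have h2 : ∀ x : Sticker, piece x = piece 7 → 3 * orient x = 0 := by decide +kernel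
    have h3 : ∀ x : Sticker, piece x = piece 8 → 2 * orient x = 0 := by decide +kernel
    intro x y hx hy hxy
    have h2 := h2 x hx
    have h3 := h3 y hy
    revert h2 h3 hxy
    generalize orient x = a
    generalize orient y = b
    revert a b
    decide
  obtain ⟨z7, z8⟩ := hzero _ _ (hpiece 7) (hpiece 8) (by rw [← h7, ← h8, hsum])
  have hψ : ∀ k, ψ k = 0 := fun k => by
    rcases exists_mem_base_or k with ⟨y, hy, rfl⟩ | rfl | rfl | rfl
    exacts [hb y hy, h7.trans z7, h8.trans z8, h9]
  have hinj : ∀ x y : Sticker, piece x = piece y → orient x = orient y → x = y := by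
    decide +kernel
  exact Subtype.ext (Equiv.ext fun x =>
    hinj _ _ (hpiece x) (by rw [h.orient_apply, hψ, add_zero]; rfl))

/-- Every state is solved by sifting it through the chain: 154 moves always suffice. -/
theorem d_le (g : State) : d g ≤ 154 := by
  have hlen : maxLength lastTransversal + chainLength transversals ≤ 154 := by decide +kernel
  have hg : ∀ y ∈ centres, g.1 y = y := by
    obtain ⟨_, _, h⟩ := exists_actsOnPieces g.2
    exact h.centre_apply
  refine (d_le_of_isChain _ _ isChain_transversals (fun h hh => ?_) hg).trans hlen
  have h1 : ∀ w ∈ lastTransversal, ∀ y ∈ base, w.run y = y := by decide +kernel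
  have h2 : ∀ x : Sticker, piece x = piece 9 → x.val ∈ lastTransversal.map (Word.run · 9) := by
    decide +kernel
  have := d_le_add_maxLength (b := 9) (k := 0) h1 (fun t ht => by simp [eq_one_of_fixes ht, d]) hh
    (h2 _ (by
      obtain ⟨σ, ψ, hσ⟩ := exists_actsOnPieces h.2
      rw [hσ.piece_apply, hσ.eq_one hh]; rfl))
  rwa [zero_add] at this

open MeasureTheory ProbabilityTheory

/-! ### The diameter and the average distance -/

theorem diam_le : cubeGraph.diam ≤ 154 := by
  obtain ⟨u, v, h⟩ := cubeGraph.exists_dist_eq_diam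
  have := dist_mul_left v⁻¹ u v
  rw [inv_mul_cancel] at this
  rw [← h, ← this]
  exact d_le (v⁻¹ * u)

noncomputable instance : Fintype State := Fintype.ofFinite State

/-- The average distance of a state to the solved state. -/
noncomputable def meanDist : ℝ := (∑ s : State, (d s : ℝ)) / Fintype.card State

theorem sum_dist_eq (u : State) : ∑ s, cubeGraph.dist s u = ∑ s, d s := by
  rw [← Equiv.sum_comp (Equiv.mulLeft u)]
  refine Finset.sum_congr rfl fun s _ => ?_
  have := dist_mul_left u s 1
  rwa [mul_one] at this

/-- A state is on average at distance `meanDist` from each end of a diameter, by vertex-transitivity,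
and the sum of the two distances is at least the diameter. -/
theorem diam_le_two_mul_meanDist : (cubeGraph.diam : ℝ) ≤ 2 * meanDist := by
  obtain ⟨u, v, h⟩ := cubeGraph.exists_dist_eq_diam
  have key : Fintype.card State * cubeGraph.diam ≤ 2 * ∑ s, d s := by
    calc Fintype.card State * cubeGraph.diam
        = ∑ _s : State, cubeGraph.diam := by simp
      _ ≤ ∑ s : State, (cubeGraph.dist s u + cubeGraph.dist s v) := by
          refine Finset.sum_le_sum fun s _ => ?_
          rw [← h, SimpleGraph.dist_comm (u := s) (v := u)]
          exact cubeGraph_connected.dist_triangle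
      _ = 2 * ∑ s, d s := by
          rw [Finset.sum_add_distrib, sum_dist_eq, sum_dist_eq, two_mul]
  have hcard : (0 : ℝ) < Fintype.card State := by exact_mod_cast Fintype.card_pos
  have key' : (Fintype.card State : ℝ) * cubeGraph.diam ≤ 2 * ∑ s, (d s : ℝ) := by
    exact_mod_cast key
  rw [meanDist, ← mul_div_assoc, le_div_iff₀ hcard]
  linarith

theorem integral_d_uniformOn : ∫ s, (d s : ℝ) ∂(uniformOn (Set.univ : Set State)) = meanDist := by
  have := isProbabilityMeasure_uniformOn (Set.finite_univ (α := State)) Set.univ_nonempty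
  rw [integral_fintype .of_finite, meanDist, Finset.sum_div]
  refine Finset.sum_congr rfl fun s _ => ?_
  rw [measureReal_def, uniformOn_univ]
  simp [div_eq_inv_mul]

/-! ### Concentration of the sample mean -/

/-- Hoeffding's inequality for the sample mean of independent uniform states, whose distances to
the solved state lie between `0` and `154`. -/
theorem measureReal_sampleMean_add_le {Ω : Type*} [MeasurableSpace Ω] (P : Measure Ω)
    [IsProbabilityMeasure P] (n : ℕ) (S : Fin n → Ω → State) (hmeas : ∀ i, Measurable (S i))
    (hindep : iIndepFun S P) (hunif : ∀ i, P.map (S i) = uniformOn Set.univ) {t : ℝ} (ht : 0 ≤ t) :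
    P.real {ω | (n : ℝ) * t ≤ ∑ i, (meanDist - d (S i ω))} ≤
      Real.exp (-(n * t) ^ 2 / (2 * (n * 77 ^ 2))) := by
  have hd : Measurable fun s : State => meanDist - d s := measurable_from_top
  have hind : iIndepFun (fun i ω => meanDist - d (S i ω)) P :=
    hindep.comp (fun _ s => meanDist - d s) fun _ => hd
  have hsub : ∀ i ∈ (Finset.univ : Finset (Fin n)),
      HasSubgaussianMGF (fun ω => meanDist - d (S i ω))
        ((‖meanDist - (meanDist - 154)‖₊ / 2) ^ 2) P := by
    intro i _
    refine hasSubgaussianMGF_of_mem_Icc_of_integral_eq_zero (hd.comp (hmeas i)).aemeasurable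
      (ae_of_all _ fun ω => ?_) ?_
    · have h : (d (S i ω) : ℝ) ≤ 154 := by exact_mod_cast d_le (S i ω)
      have h' : (0 : ℝ) ≤ d (S i ω) := Nat.cast_nonneg _
      constructor <;> linarith
    · have h := integral_map (μ := P) (hmeas i).aemeasurable
        (f := fun s : State => meanDist - d s) hd.aestronglyMeasurable
      have := isProbabilityMeasure_uniformOn (Set.finite_univ (α := State)) Set.univ_nonempty
      rw [← h, hunif i, integral_sub .of_finite .of_finite, integral_d_uniformOn]
      simp
  have h := HasSubgaussianMGF.measure_sum_ge_le_of_iIndepFun hind hsub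
    (mul_nonneg (Nat.cast_nonneg n) ht)
  refine h.trans_eq ?_
  congr 2
  push_cast
  rw [sub_sub_cancel, Real.norm_ofNat, Finset.sum_const, Finset.card_univ, Fintype.card_fin,
    nsmul_eq_mul]
  norm_num

end Rubik

theorem theorem1 {Ω : Type*} [MeasurableSpace Ω] (P : MeasureTheory.Measure Ω)
    [MeasureTheory.IsProbabilityMeasure P] (n : ℕ) (S : Fin n → Ω → Rubik.State)
    (hmeas : ∀ i, Measurable (S i))
    (hindep : ProbabilityTheory.iIndepFun S P)
    (hunif : ∀ i, P.map (S i) = ProbabilityTheory.uniformOn Set.univ) :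
    P.real {ω | 2 * Rubik.sampleMean (fun i => S i ω) + 0.36 ≤ (Rubik.cubeGraph.diam : ℝ)}
      < 2 * Real.exp (-(n : ℝ) / 1541939) := by
  have hsub : {ω | 2 * Rubik.sampleMean (fun i => S i ω) + 0.36 ≤ (Rubik.cubeGraph.diam : ℝ)} ⊆
      {ω | (n : ℝ) * 0.18 ≤ ∑ i, (Rubik.meanDist - Rubik.d (S i ω))} := by
    intro ω hω
    have h1 := hω.out.trans Rubik.diam_le_two_mul_meanDist
    have h2 : Rubik.sampleMean (fun i => S i ω) ≤ Rubik.meanDist - 0.18 := by linarith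
    rcases Nat.eq_zero_or_pos n with rfl | hn
    · simp
    · have hn' : (0 : ℝ) < n := by exact_mod_cast hn
      rw [Rubik.sampleMean, div_le_iff₀ hn'] at h2
      simp only [Set.mem_ofPred_eq, Finset.sum_sub_distrib, Finset.sum_const, Finset.card_univ,
        Fintype.card_fin, nsmul_eq_mul]
      linarith
  calc P.real _ ≤ P.real _ := MeasureTheory.measureReal_mono hsub
    _ ≤ Real.exp (-(n * 0.18) ^ 2 / (2 * (n * 77 ^ 2))) :=
        Rubik.measureReal_sampleMean_add_le P n S hmeas hindep hunif (by norm_num)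
    _ ≤ Real.exp (-(n : ℝ) / 1541939) := by
        refine Real.exp_le_exp.2 ?_
        rcases Nat.eq_zero_or_pos n with rfl | hn
        · simp
        · have hn' : (0 : ℝ) < n := by exact_mod_cast hn
          have h : -((n : ℝ) * 0.18) ^ 2 / (2 * (n * 77 ^ 2)) = n * (-0.18 ^ 2 / (2 * 77 ^ 2)) := by
            field_simp
          have h' : -(n : ℝ) / 1541939 = n * (-1 / 1541939) := by ring
          rw [h, h']
          exact mul_le_mul_of_nonneg_left (by norm_num) hn'.le
    _ < 2 * Real.exp (-(n : ℝ) / 1541939) := lt_two_mul_self (Real.exp_pos _)
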